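/- **Definitions.** Let $m\ge 0$, $n=2^m$ and $[m]=\{1,\dots,m\}$. For $A\subseteq[m]$ let $v_m(A)\in\mathbb F_2^{\{0,1\}^m}$ be the evaluation vector $v_m(A,z)=\prod_{i\in A}z_i$. A BMS channel is a channel $W:\{0,1\}\to\mathcal Y$ with finite output alphabet $\mathcal Y$ for which there is a permutation $\pi$ of $\mathcal Y$ with $\pi^{-1}=\pi$ and $W(y|1)=W(\pi(y)|0)$ for all $y\in\mathcal Y$. Order the subsets of $[m]$ totally by: $A<B$ if $|A|>|B|$, or if $|A|=|B|$, $A=\{a_1>a_2>\cdots\}$, $B=\{b_1>b_2>\cdots\}$ and there is an $i$ with $a_j=b_j$ for all $j<i$ and $a_i<b_i$. Let $(U_A)_{A\subseteq[m]}$ be $n$ i.i.d. Bernoulli-$1/2$ bits, let $X=\sum_{A\subseteq[m]}U_A\,v_m(A)$ (over $\mathbb F_2$), send the $n$ coordinates of $X$ through $n$ independent copies of $W$, and let $Y$ be the vector of outputs. Put $U_{<A}=(U_B)_{B<A}$ and $$H_A^{(m)}=H(U_A\mid Y,U_{<A}),\qquad Z_A^{(m)}=Z(U_A\mid Y,U_{<A}),$$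 where $H$ is the conditional entropy in bits and $Z(X|Y)=\sum_{y}\sqrt{P_{Y|X}(y|0)P_{Y|X}(y|1)}$ is the Bhattacharyya parameter. **Theorem.** Let $0<\epsilon<0.1$ and $0<\gamma<1$, and let $(\delta_n)$ be a sequence that decays at most polynomially in $n$, i.e. $\delta_n\ge c\,n^{-d}$ for some constants $c,d>0$ and all sufficiently large $n$. Then there is a constant $M$, depending only on $\epsilon$, $(\delta_n)$ and $\gamma$, such that for every BMS channel $W$, every $m>M$ and every increasing chain of sets $\emptyset=A_0\subseteq A_1\subseteq\dots\subseteq A_m=[m]$ with $|A_i|=i$ for all $i$, $$\left|\left\{i\in\{0,\dots,m\}:H_{A_i}^{(m)}>1-\epsilon\right\}\cup\left\{i\in\{0,\dots,m\}:Z_{A_i}^{(m)}<\delta_n\right\}\right|\ \ge\ m-m^{\gamma},\qquad n=2^m.$$ -/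

import Mathlib

namespace RMPolar

noncomputable section

/-! ### Finite probability: conditional entropy and the Bhattacharyya parameter

A finite probability space is given by a finite type `Ω` and a mass function `p : Ω → ℝ`; random
variables are functions on `Ω`. -/

/-- The probability `P(X = a)`. -/
def law {Ω α : Type*} [Fintype Ω] [DecidableEq α] (p : Ω → ℝ) (X : Ω → α) (a : α) : ℝ :=
  ∑ ω with X ω = a, p ω

/-- The conditional entropy in bits,
`H(X | Y) = - ∑_{x, y} P(X = x, Y = y) log₂ P(X = x | Y = y)`, where `0 log₂ 0 = 0`. -/
def condEntropy {Ω α β : Type*} [Fintype Ω] [Fintype α] [DecidableEq α] [Fintype β]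
    [DecidableEq β] (p : Ω → ℝ) (X : Ω → α) (Y : Ω → β) : ℝ :=
  -∑ x, ∑ y, law p (fun ω => (X ω, Y ω)) (x, y) *
    Real.logb 2 (law p (fun ω => (X ω, Y ω)) (x, y) / law p Y y)

/-- The conditional probability `P(Y = y | X = x)`. -/
def condLaw {Ω α β : Type*} [Fintype Ω] [DecidableEq α] [DecidableEq β]
    (p : Ω → ℝ) (Y : Ω → β) (X : Ω → α) (y : β) (x : α) : ℝ :=
  law p (fun ω => (X ω, Y ω)) (x, y) / law p X x

/-- The Bhattacharyya parameter `Z(X | Y) = ∑_y √(P(Y = y | X = 0) P(Y = y | X = 1))` of a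
binary random variable `X`, uniformly distributed in the intended use. -/
def bhattacharyya {Ω β : Type*} [Fintype Ω] [Fintype β] [DecidableEq β]
    (p : Ω → ℝ) (X : Ω → ZMod 2) (Y : Ω → β) : ℝ :=
  ∑ y, Real.sqrt (condLaw p Y X y 0 * condLaw p Y X y 1)

/-! ### Channels -/

/-- A binary memoryless symmetric channel with finite output alphabet `𝒴`: transition
probabilities `prob x y = W(y | x)` such that some involution `π` of `𝒴` satisfies
`W(y | 1) = W(π y | 0)` for all `y`. -/
structure BMSChannel (𝒴 : Type*) [Fintype 𝒴] where
  prob : ZMod 2 → 𝒴 → ℝ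
  prob_nonneg : ∀ x y, 0 ≤ prob x y
  sum_prob : ∀ x, ∑ y, prob x y = 1
  symmetric : ∃ π : Equiv.Perm 𝒴, π⁻¹ = π ∧ ∀ y, prob 1 y = prob 0 (π y)

/-! ### Reed-Muller codes over a channel

The set `[m]` is `Fin m`, so that its subsets are the terms of `Finset (Fin m)`, and binary
vectors `z ∈ {0,1}^m` are functions `Fin m → ZMod 2`. -/

/-- The evaluation at `z` of the monomial `∏_{i ∈ A} Z_i`. -/
def monomialEval {m : ℕ} (A : Finset (Fin m)) (z : Fin m → ZMod 2) : ZMod 2 :=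
  ∏ i ∈ A, z i

/-- The vector `∑_A u_A v_m(A)` with `v_m(A)` the evaluation vector of the monomial of `A`. -/
def encode {m : ℕ} (u : Finset (Fin m) → ZMod 2) (z : Fin m → ZMod 2) : ZMod 2 :=
  ∑ A, u A * monomialEval A z

/-- The Reed-Muller total order: `A < B` if `|A| > |B|`, or if `|A| = |B|` and, with the elements
of both sets listed in decreasing order, `A` has the smaller element at the first place where the
lists differ. For sets of the same size the latter is Mathlib's colexicographic order. -/
def rmLT {m : ℕ} (A B : Finset (Fin m)) : Prop :=
  B.card < A.card ∨ (A.card = B.card ∧ toColex A < toColex B)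

instance {m : ℕ} (A B : Finset (Fin m)) : Decidable (rmLT A B) :=
  inferInstanceAs (Decidable (_ ∨ _))

/-- The sample space of the pair `(U, Y)` of the information bits `(U_A : A ⊆ [m])` and the
channel outputs `(Y_z : z ∈ {0,1}^m)`. -/
abbrev Sample (m : ℕ) (𝒴 : Type*) : Type _ :=
  (Finset (Fin m) → ZMod 2) × ((Fin m → ZMod 2) → 𝒴)

/-- The joint law of `(U, Y)`: the `2^m` bits `U_A` are independent and uniform, and the vector
`X = encode U` is sent through `2^m` independent copies of `W`. -/
def jointLaw {𝒴 : Type*} [Fintype 𝒴] (W : BMSChannel 𝒴) (m : ℕ) (ω : Sample m 𝒴) : ℝ :=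
  (1 / 2) ^ (2 ^ m) * ∏ z, W.prob (encode ω.1 z) (ω.2 z)

/-- The random bit `U_A`. -/
def bit {𝒴 : Type*} {m : ℕ} (A : Finset (Fin m)) (ω : Sample m 𝒴) : ZMod 2 :=
  ω.1 A

/-- The observation `(Y, U_{<A})` with `U_{<A} = (U_B : B < A)`. -/
def observation {𝒴 : Type*} {m : ℕ} (A : Finset (Fin m)) (ω : Sample m 𝒴) :
    ((Fin m → ZMod 2) → 𝒴) × ({B : Finset (Fin m) // rmLT B A} → ZMod 2) :=
  (ω.2, fun B => ω.1 B.1)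

/-- `H_A^{(m,W)} = H(U_A | Y, U_{<A})`. -/
def rmEntropy {𝒴 : Type*} [Fintype 𝒴] [DecidableEq 𝒴] (W : BMSChannel 𝒴) {m : ℕ}
    (A : Finset (Fin m)) : ℝ :=
  condEntropy (jointLaw W m) (bit A) (observation A)

/-- `Z_A^{(m,W)} = Z(U_A | Y, U_{<A})`. -/
def rmBhattacharyya {𝒴 : Type*} [Fintype 𝒴] [DecidableEq 𝒴] (W : BMSChannel 𝒴) {m : ℕ}
    (A : Finset (Fin m)) : ℝ :=
  bhattacharyya (jointLaw W m) (bit A) (observation A)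

/-- An increasing chain `A_0 ⊆ A_1 ⊆ ⋯ ⊆ A_m` of subsets of `[m]` with `|A_i| = i`; in particular
`A_0 = ∅` and `A_m = [m]`. -/
def IsIncreasingChain {m : ℕ} (A : Fin (m + 1) → Finset (Fin m)) : Prop :=
  Monotone A ∧ ∀ i, (A i).card = i

/-- The sequence `δ` decays at most polynomially: `δ_n ≥ c n^{-d}` for some `c, d > 0` and all
sufficiently large `n`. -/
def AtLeastInvPoly (δ : ℕ → ℝ) : Prop :=
  ∃ c d : ℝ, 0 < c ∧ 0 < d ∧ ∀ᶠ n : ℕ in Filter.atTop, c * (n : ℝ) ^ (-d) ≤ δ n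

end

end RMPolar

/-! Polarization is fast along every chain because inserting one element acts like a polar step: for
`i ∉ A`, Z_A ≤ (Z_{A ∪ {i}})² (`rmBhattacharyya_le_sq_insert`).

To see this, split the code along `z_i`. The half `z_i = 0` carries the coefficients `u_B` with `i ∉
B`, the half `z_i = 1` the sums `u_B + u_{B \ {i}}` with `i ∈ B`. This change of coordinates is
bijective, so the halves are independent. Let X₁ = U_A and X₂ = U_A + U_{A ∪ {i}} be observed
through S and T in the two halves. Then U_{A ∪ {i}} = X₁ + X₂, and the order of the sets is such
that (Y, U_{<A}) determines (S, T, X₁ + X₂), while (S, T) determines (Y, U_{<A ∪ {i}}). By data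
processing and the plus transform, Z_A ≤ Z(X₁|S) Z(X₂|T); by the minus transform, each factor is at
most Z_{A ∪ {i}}.

Call an index bad if H ≤ 1 - ε and Z ≥ δ. If i < j are bad, then Z at j is at most r = 1 - ε²/2,
hence Z at i is at most r^(2^(j-i)). For j - i ≥ m^γ this is eventually below every inverse
polynomial in 2^m, a contradiction. So the bad indices lie within a window shorter than m^γ. -/

namespace RMPolar

open Finset

/-! ### Laws, data processing and the two polar transforms -/

section FiniteProbability

variable {Ω α β σ τ : Type*} [Fintype Ω]

lemma law_nonneg [DecidableEq α] {p : Ω → ℝ} (hp : ∀ ω, 0 ≤ p ω) (X : Ω → α) (a : α) :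
    0 ≤ law p X a :=
  sum_nonneg fun ω _ => hp ω

lemma sum_law [Fintype α] [DecidableEq α] (p : Ω → ℝ) (X : Ω → α) :
    ∑ a, law p X a = ∑ ω, p ω :=
  sum_fiberwise univ X p

lemma law_pair_map [DecidableEq α] [DecidableEq β] [Fintype σ] [DecidableEq σ]
    (p : Ω → ℝ) (X : Ω → α) (Y : Ω → σ) (f : σ → β) (x : α) (b : β) :
    law p (fun ω => (X ω, f (Y ω))) (x, b) =
      ∑ y with f y = b, law p (fun ω => (X ω, Y ω)) (x, y) := by
  unfold law
  rw [sum_filter, sum_filter]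
  simp_rw [sum_filter]
  have : ∀ y : σ, (if f y = b then ∑ a, if (X a, Y a) = (x, y) then p a else 0 else 0) =
      ∑ a, if Y a = y then (if X a = x ∧ f (Y a) = b then p a else 0) else 0 := by
    intro y
    split_ifs with h
    · refine sum_congr rfl fun a _ => ?_
      by_cases h1 : Y a = y <;> by_cases h2 : X a = x <;> simp [h1, h2, h]
    · symm
      refine sum_eq_zero fun a _ => ?_
      by_cases h1 : Y a = y <;> simp [h1, h]
  simp_rw [this]
  rw [sum_comm]
  simp

lemma sum_law_pair_left [Fintype α] [DecidableEq α] [DecidableEq β] (p : Ω → ℝ)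
    (X : Ω → α) (Y : Ω → β) (y : β) :
    ∑ x, law p (fun ω => (X ω, Y ω)) (x, y) = law p Y y := by
  unfold law
  rw [← sum_fiberwise (univ.filter fun ω => Y ω = y) X p]
  refine sum_congr rfl fun x _ => sum_congr ?_ fun _ _ => rfl
  ext ω
  simp [and_comm]

/-- The Bhattacharyya parameter of a uniform bit `X`, in terms of the joint law of `X` and `Y`. -/
noncomputable def jointBhattacharyya [Fintype β] [DecidableEq β]
    (p : Ω → ℝ) (X : Ω → ZMod 2) (Y : Ω → β) : ℝ :=
  2 * ∑ y, Real.sqrt (law p (fun ω => (X ω, Y ω)) (0, y) * law p (fun ω => (X ω, Y ω)) (1, y))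

lemma jointBhattacharyya_nonneg [Fintype β] [DecidableEq β]
    (p : Ω → ℝ) (X : Ω → ZMod 2) (Y : Ω → β) : 0 ≤ jointBhattacharyya p X Y := by
  unfold jointBhattacharyya
  positivity

lemma bhattacharyya_eq_joint [Fintype β] [DecidableEq β] {p : Ω → ℝ} {X : Ω → ZMod 2}
    (hX : ∀ x, law p X x = 1 / 2) (Y : Ω → β) :
    bhattacharyya p X Y = jointBhattacharyya p X Y := by
  unfold bhattacharyya jointBhattacharyya condLaw
  rw [mul_sum]
  refine sum_congr rfl fun y _ => ?_
  rw [hX, hX]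
  set a := law p (fun ω => (X ω, Y ω)) (0, y)
  set b := law p (fun ω => (X ω, Y ω)) (1, y)
  have : a / (1 / 2) * (b / (1 / 2)) = 2 ^ 2 * (a * b) := by ring
  rw [this, Real.sqrt_mul (by positivity), Real.sqrt_sq (by norm_num)]

/-- Data processing: a finer observation has a smaller Bhattacharyya parameter. -/
lemma jointBhattacharyya_le_of_factorsThrough [Fintype β] [DecidableEq β] [Fintype σ]
    [DecidableEq σ] {p : Ω → ℝ} (hp : ∀ ω, 0 ≤ p ω) (X : Ω → ZMod 2) {Y : Ω → β} {Y' : Ω → σ}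
    (h : Y.FactorsThrough Y') : jointBhattacharyya p X Y' ≤ jointBhattacharyya p X Y := by
  rcases isEmpty_or_nonempty Ω with hΩ | ⟨⟨ω₀⟩⟩
  · simp [jointBhattacharyya, law]
  have : Nonempty β := ⟨Y ω₀⟩
  obtain ⟨f, rfl⟩ := (Function.factorsThrough_iff Y).1 h
  unfold jointBhattacharyya
  refine mul_le_mul_of_nonneg_left ?_ zero_le_two
  rw [← sum_fiberwise univ f]
  refine sum_le_sum fun b _ => ?_
  simp only [Function.comp_apply]
  rw [law_pair_map, law_pair_map, Real.sqrt_mul (sum_nonneg fun _ _ => law_nonneg hp _ _)]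
  simp_rw [Real.sqrt_mul (law_nonneg hp _ _)]
  -- Cauchy–Schwarz on each fibre of `f`.
  exact Real.sum_sqrt_mul_sqrt_le _ (fun _ => law_nonneg hp _ _) (fun _ => law_nonneg hp _ _)

variable {Ω₁ Ω₂ : Type*} [Fintype Ω₁] [Fintype Ω₂]

lemma law_prod [DecidableEq α] [DecidableEq β] {p : Ω → ℝ} {F : Ω₁ → ℝ} {G : Ω₂ → ℝ}
    (e : Ω ≃ Ω₁ × Ω₂) (hp : ∀ ω, p ω = F (e ω).1 * G (e ω).2) (f : Ω₁ → α) (g : Ω₂ → β)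
    (a : α) (b : β) :
    law p (fun ω => (f (e ω).1, g (e ω).2)) (a, b) = law F f a * law G g b := by
  unfold law
  rw [sum_mul_sum, ← sum_product']
  refine sum_equiv e (fun ω => ?_) fun ω _ => hp ω
  simp

lemma law_congr [DecidableEq α] [DecidableEq β] (p : Ω → ℝ) {X : Ω → α} {Y : Ω → β} {a : α}
    {b : β} (h : ∀ ω, X ω = a ↔ Y ω = b) : law p X a = law p Y b := by
  unfold law
  simp_rw [h]

section Product

variable [Fintype σ] [DecidableEq σ] [Fintype τ] [DecidableEq τ]
  {p : Ω → ℝ} {F : Ω₁ → ℝ} {G : Ω₂ → ℝ} (e : Ω ≃ Ω₁ × Ω₂)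

/-- The plus transform: the Bhattacharyya parameters of two independent observations of bits with
a known sum multiply. -/
lemma jointBhattacharyya_plus (hp : ∀ ω, p ω = F (e ω).1 * G (e ω).2) (hF : ∀ ω, 0 ≤ F ω)
    (hG : ∀ ω, 0 ≤ G ω) (X₁ : Ω₁ → ZMod 2) (X₂ : Ω₂ → ZMod 2) (S : Ω₁ → σ) (T : Ω₂ → τ) :
    jointBhattacharyya p (fun ω => X₁ (e ω).1)
        (fun ω => (S (e ω).1, T (e ω).2, X₁ (e ω).1 + X₂ (e ω).2)) =
      jointBhattacharyya F X₁ S * jointBhattacharyya G X₂ T := by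
  have key : ∀ x s t w, law p (fun ω => (X₁ (e ω).1, S (e ω).1, T (e ω).2,
      X₁ (e ω).1 + X₂ (e ω).2)) (x, s, t, w) =
      law F (fun ω => (X₁ ω, S ω)) (x, s) * law G (fun ω => (X₂ ω, T ω)) (w - x, t) := by
    intro x s t w
    rw [← law_prod e hp]
    refine law_congr p fun ω => ?_
    simp only [Prod.mk.injEq, eq_sub_iff_add_eq']
    constructor
    · rintro ⟨rfl, rfl, rfl, rfl⟩; simp
    · rintro ⟨⟨rfl, rfl⟩, h, rfl⟩; simp [h]
  unfold jointBhattacharyya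
  simp_rw [Fintype.sum_prod_type, key]
  set P := law F fun ω => (X₁ ω, S ω)
  set Q := law G fun ω => (X₂ ω, T ω)
  have hP : ∀ a, 0 ≤ P a := law_nonneg hF _
  have hQ : ∀ a, 0 ≤ Q a := law_nonneg hG _
  -- Changing the known sum `w` only swaps the two values of `Q`. Both values of `w` contribute
  -- equally, which supplies the second normalizing factor 2.
  have split : ∀ s t (w : ZMod 2), Real.sqrt (P (0, s) * Q (w - 0, t) * (P (1, s) * Q (w - 1, t))) =
      Real.sqrt (P (0, s) * P (1, s)) * Real.sqrt (Q (0, t) * Q (1, t)) := by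
    intro s t w
    rw [← Real.sqrt_mul (mul_nonneg (hP _) (hP _))]
    congr 1
    have h01 : ((0 : ZMod 2) - 1) = 1 := by decide
    rcases (by decide : ∀ w : ZMod 2, w = 0 ∨ w = 1) w with rfl | rfl
    · rw [sub_zero, h01]; ring
    · rw [sub_zero, sub_self]; ring
  simp_rw [split]
  simp only [sum_const, card_univ, ZMod.card, nsmul_eq_mul, Nat.cast_ofNat]
  simp_rw [← mul_sum, ← sum_mul]
  ring

/-- The minus transform: the sum of two independently observed bits is no easier to estimate than
the first bit. -/
lemma jointBhattacharyya_le_minus (hp : ∀ ω, p ω = F (e ω).1 * G (e ω).2) (hF : ∀ ω, 0 ≤ F ω)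
    (hG : ∀ ω, 0 ≤ G ω) (hG1 : ∑ ω, G ω = 1)
    (X₁ : Ω₁ → ZMod 2) (X₂ : Ω₂ → ZMod 2) (S : Ω₁ → σ) (T : Ω₂ → τ) :
    jointBhattacharyya F X₁ S ≤
      jointBhattacharyya p (fun ω => X₁ (e ω).1 + X₂ (e ω).2)
        (fun ω => (S (e ω).1, T (e ω).2)) := by
  have hp0 : ∀ ω, 0 ≤ p ω := fun ω => by rw [hp]; exact mul_nonneg (hF _) (hG _)
  -- Let a genie reveal X₂ as well: estimating X₁ + X₂ is then the same as estimating X₁ from S, so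
  -- the finer observation has exactly the parameter of the first bit.
  refine le_trans (le_of_eq ?_) (jointBhattacharyya_le_of_factorsThrough hp0
    (fun ω => X₁ (e ω).1 + X₂ (e ω).2) (Y' := fun ω => (S (e ω).1, X₂ (e ω).2, T (e ω).2)) ?_)
  · have key : ∀ x s v t, law p (fun ω => (X₁ (e ω).1 + X₂ (e ω).2, S (e ω).1, X₂ (e ω).2,
        T (e ω).2)) (x, s, v, t) =
        law F (fun ω => (X₁ ω, S ω)) (x - v, s) * law G (fun ω => (X₂ ω, T ω)) (v, t) := by
      intro x s v t
      rw [← law_prod e hp]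
      refine law_congr p fun ω => ?_
      simp only [Prod.mk.injEq, eq_sub_iff_add_eq]
      constructor
      · rintro ⟨rfl, rfl, rfl, rfl⟩; simp
      · rintro ⟨⟨h, rfl⟩, rfl, rfl⟩; simp [h]
    have hQ1 : ∑ v, ∑ t, law G (fun ω => (X₂ ω, T ω)) (v, t) = 1 := by
      rw [← Fintype.sum_prod_type', sum_law, hG1]
    unfold jointBhattacharyya
    simp_rw [Fintype.sum_prod_type, key]
    set P := law F fun ω => (X₁ ω, S ω)
    set Q := law G fun ω => (X₂ ω, T ω)
    have hP : ∀ a, 0 ≤ P a := law_nonneg hF _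
    have hQ : ∀ a, 0 ≤ Q a := law_nonneg hG _
    have split : ∀ s (v : ZMod 2) t,
        Real.sqrt (P (0 - v, s) * Q (v, t) * (P (1 - v, s) * Q (v, t))) =
        Real.sqrt (P (0, s) * P (1, s)) * Q (v, t) := by
      intro s v t
      have : P (0 - v, s) * Q (v, t) * (P (1 - v, s) * Q (v, t)) =
          P (0, s) * P (1, s) * Q (v, t) ^ 2 := by
        have h01 : ((0 : ZMod 2) - 1) = 1 := by decide
        rcases (by decide : ∀ v : ZMod 2, v = 0 ∨ v = 1) v with rfl | rfl
        · rw [sub_zero, sub_zero]; ring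
        · rw [h01, sub_self]; ring
      rw [this, Real.sqrt_mul (mul_nonneg (hP _) (hP _)), Real.sqrt_sq (hQ _)]
    simp_rw [split, ← mul_sum, hQ1, mul_one]
  · intro ω ω' h
    simp only [Prod.mk.injEq] at h ⊢
    exact ⟨h.1, h.2.2⟩

end Product

end FiniteProbability

/-! ### Entropy versus the Bhattacharyya parameter -/

lemma two_mul_le_binEntropy {p : ℝ} (h0 : 0 ≤ p) (h1 : p ≤ 1 / 2) :
    2 * p * Real.log 2 ≤ Real.binEntropy p := by
  -- By concavity the graph lies above its chord from 0 to 1/2.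
  have h := Real.strictConcave_binEntropy.concaveOn.2 (show (0 : ℝ) ∈ Set.Icc 0 1 by norm_num)
    (show (2⁻¹ : ℝ) ∈ Set.Icc 0 1 by norm_num)
    (show 0 ≤ 1 - 2 * p by linarith) (show 0 ≤ 2 * p by linarith) (by ring)
  simp only [Real.binEntropy_zero, Real.binEntropy_two_inv, smul_eq_mul, mul_zero, zero_add] at h
  rwa [show 2 * p * 2⁻¹ = p by ring] at h

/-- The left side is 2 min(a, b), so this is the chord bound at p = min(a, b) / (a + b), scaled by a
+ b. -/
lemma sub_abs_le_entropy {a b : ℝ} (ha : 0 ≤ a) (hb : 0 ≤ b) :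
    (a + b) - |a - b| ≤
      -(a * Real.logb 2 (a / (a + b)) + b * Real.logb 2 (b / (a + b))) := by
  wlog hab : a ≤ b generalizing a b
  · have := this hb ha (le_of_not_ge hab)
    rwa [abs_sub_comm, add_comm b a, add_comm (b * _)] at this
  rcases (add_nonneg ha hb).eq_or_lt with hs | hs
  · have h1 : a = 0 := by linarith
    have h2 : b = 0 := by linarith
    simp [h1, h2]
  have h2 : 0 < Real.log 2 := Real.log_pos one_lt_two
  have h := two_mul_le_binEntropy (p := a / (a + b)) (by positivity)
    (by rw [div_le_iff₀ hs]; linarith)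
  have h3 : 1 - a / (a + b) = b / (a + b) := by field_simp; ring
  rw [Real.binEntropy, h3, Real.log_inv, Real.log_inv] at h
  rw [abs_of_nonpos (by linarith)]
  unfold Real.logb
  have h4 := mul_le_mul_of_nonneg_left h hs.le
  have h5 : (a + b) * (2 * (a / (a + b)) * Real.log 2) = 2 * a * Real.log 2 := by
    field_simp
  have h6 : (a + b) * (a / (a + b) * -Real.log (a / (a + b)) +
      b / (a + b) * -Real.log (b / (a + b))) =
      -(a * Real.log (a / (a + b)) + b * Real.log (b / (a + b))) := by
    field_simp
    ring
  rw [h5, h6] at h4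
  have h7 : -(a * (Real.log (a / (a + b)) / Real.log 2) + b * (Real.log (b / (a + b)) / Real.log 2))
      = -(a * Real.log (a / (a + b)) + b * Real.log (b / (a + b))) / Real.log 2 := by ring
  rw [h7, le_div_iff₀ h2]
  linarith

/-- With a = x² and b = y², the right side minus the left is (|x - y| - t(x + y)/2)² + (t(x -
y)/2)². The bound is linear in a + b and |a - b|, so it can be summed over outputs with a fixed t.
-/
lemma two_mul_sqrt_mul_le {a b : ℝ} (ha : 0 ≤ a) (hb : 0 ≤ b) (t : ℝ) :
    2 * Real.sqrt (a * b) ≤ (1 + t ^ 2 / 2) * (a + b) - t * |a - b| := by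
  rw [Real.sqrt_mul ha]
  obtain ⟨x, hx, rfl⟩ : ∃ x, 0 ≤ x ∧ x ^ 2 = a := ⟨√a, Real.sqrt_nonneg a, Real.sq_sqrt ha⟩
  obtain ⟨y, hy, rfl⟩ : ∃ y, 0 ≤ y ∧ y ^ 2 = b := ⟨√b, Real.sqrt_nonneg b, Real.sq_sqrt hb⟩
  rw [Real.sqrt_sq hx, Real.sqrt_sq hy]
  have h1 : |x ^ 2 - y ^ 2| = |x - y| * (x + y) := by
    rw [sq_sub_sq, abs_mul, abs_of_nonneg (add_nonneg hx hy), mul_comm]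
  have h2 : |x - y| ^ 2 = (x - y) ^ 2 := sq_abs _
  rw [h1]
  nlinarith [sq_nonneg (|x - y| - t * (x + y) / 2), sq_nonneg (t * (x - y))]

variable {Ω β : Type*} [Fintype Ω] [Fintype β] [DecidableEq β]

/-- A bit of conditional entropy at most `1 - t` has Bhattacharyya parameter at most
`1 - t ^ 2 / 2`. -/
lemma jointBhattacharyya_le_of_condEntropy_le {p : Ω → ℝ} (hp : ∀ ω, 0 ≤ p ω)
    (hp1 : ∑ ω, p ω = 1) (X : Ω → ZMod 2) (Y : Ω → β) {t : ℝ} (ht : 0 ≤ t)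
    (hH : condEntropy p X Y ≤ 1 - t) : jointBhattacharyya p X Y ≤ 1 - t ^ 2 / 2 := by
  set P := law p fun ω => (X ω, Y ω) with hP
  have hP0 : ∀ a, 0 ≤ P a := law_nonneg hp _
  have hY : ∀ y, law p Y y = P (0, y) + P (1, y) := fun y => by
    rw [← sum_law_pair_left p X Y y]
    exact Fin.sum_univ_two _
  have hsum : ∑ y, (P (0, y) + P (1, y)) = 1 := by
    simp_rw [← hY]
    rw [sum_law, hp1]
  have hent : ∑ y, ((P (0, y) + P (1, y)) - |P (0, y) - P (1, y)|) ≤ 1 - t := by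
    refine le_trans (le_trans (sum_le_sum fun y _ => sub_abs_le_entropy (hP0 _) (hP0 _))
      (le_of_eq ?_)) hH
    unfold condEntropy
    rw [sum_comm, sum_neg_distrib]
    simp_rw [hY]
    congr 1
    refine sum_congr rfl fun y _ => ?_
    exact (Fin.sum_univ_two fun x : ZMod 2 =>
      P (x, y) * Real.logb 2 (P (x, y) / (P (0, y) + P (1, y)))).symm
  have hZ : jointBhattacharyya p X Y ≤
      ∑ y, ((1 + t ^ 2 / 2) * (P (0, y) + P (1, y)) - t * |P (0, y) - P (1, y)|) := by
    unfold jointBhattacharyya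
    rw [mul_sum]
    exact sum_le_sum fun y _ => two_mul_sqrt_mul_le (hP0 _) (hP0 _) t
  rw [sum_sub_distrib, ← mul_sum, ← mul_sum, hsum] at hZ
  rw [sum_sub_distrib, hsum] at hent
  -- With D = ∑ |P(0, y) - P(1, y)|, the two bounds read D ≥ t and Z ≤ 1 + t²/2 - tD.
  nlinarith

/-! ### Uniform bits encoded and sent through independent channels -/

section EncoderLaw

variable {𝒴 I J : Type*} [Fintype 𝒴] [Fintype I] [Fintype J]

/-- The joint law of uniform bits indexed by `I` and of the outputs of the copies of `W`, indexed
by `J`, that are fed with the image of these bits under `f`. -/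
noncomputable def encoderLaw (W : BMSChannel 𝒴) (f : (I → ZMod 2) → J → ZMod 2)
    (ω : (I → ZMod 2) × (J → 𝒴)) : ℝ :=
  (1 / 2) ^ Fintype.card I * ∏ j, W.prob (f ω.1 j) (ω.2 j)

variable (W : BMSChannel 𝒴) (f : (I → ZMod 2) → J → ZMod 2)

lemma encoderLaw_nonneg (ω : (I → ZMod 2) × (J → 𝒴)) : 0 ≤ encoderLaw W f ω :=
  mul_nonneg (by positivity) (prod_nonneg fun _ _ => W.prob_nonneg _ _)

lemma sum_encoderLaw_right [DecidableEq J] (u : I → ZMod 2) :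
    ∑ y, encoderLaw W f (u, y) = (1 / 2) ^ Fintype.card I := by
  have h := prod_univ_sum (fun _ : J => (univ : Finset 𝒴)) fun j b => W.prob (f u j) b
  simp only [W.sum_prob, prod_const_one, Fintype.piFinset_univ] at h
  simp only [encoderLaw, ← mul_sum, ← h, mul_one]

lemma sum_encoderLaw [DecidableEq I] [DecidableEq J] : ∑ ω, encoderLaw W f ω = 1 := by
  rw [Fintype.sum_prod_type]
  simp_rw [sum_encoderLaw_right]
  simp

lemma law_encoderLaw_bit [DecidableEq I] [DecidableEq J] (i : I) (x : ZMod 2) :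
    law (encoderLaw W f) (fun ω => ω.1 i) x = 1 / 2 := by
  have hlaw : ∀ x, law (encoderLaw W f) (fun ω => ω.1 i) x =
      ∑ u : I → ZMod 2, if u i = x then (1 / 2) ^ Fintype.card I else 0 := by
    intro x
    unfold law
    rw [sum_filter, Fintype.sum_prod_type]
    refine sum_congr rfl fun u _ => ?_
    split_ifs with h
    · exact sum_encoderLaw_right W f u
    · exact sum_const_zero
  -- Flipping the bit at `i` exchanges the two events and preserves the uniform weight of `u`.
  have hshift : law (encoderLaw W f) (fun ω => ω.1 i) 0 =
      law (encoderLaw W f) (fun ω => ω.1 i) 1 := by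
    rw [hlaw, hlaw]
    refine Fintype.sum_equiv (Equiv.addRight (Pi.single i 1)) _ _ fun u => ?_
    simp
  have htot : law (encoderLaw W f) (fun ω => ω.1 i) 0 +
      law (encoderLaw W f) (fun ω => ω.1 i) 1 = 1 := by
    rw [← sum_encoderLaw W f, ← sum_law _ fun ω : (I → ZMod 2) × (J → 𝒴) => ω.1 i]
    exact (Fin.sum_univ_two (law (encoderLaw W f) fun ω => ω.1 i)).symm
  rcases (by decide : ∀ x : ZMod 2, x = 0 ∨ x = 1) x with rfl | rfl <;> linarith

lemma jointLaw_eq_encoderLaw (m : ℕ) : jointLaw W m = encoderLaw W encode := by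
  ext ω
  simp [jointLaw, encoderLaw]

end EncoderLaw

/-! ### Splitting the code along one coordinate -/

section Splitting

variable {m : ℕ} (i : Fin m)

/-- Replaces `u_B` by `u_B + u_{B \ {i}}` for `i ∈ B`. -/
def shear (u : Finset (Fin m) → ZMod 2) (B : Finset (Fin m)) : ZMod 2 :=
  if i ∈ B then u B + u (B.erase i) else u B

lemma shear_shear (u : Finset (Fin m) → ZMod 2) : shear i (shear i u) = u := by
  ext B
  by_cases h : i ∈ B
  · simp only [shear, if_pos h, notMem_erase, if_false, add_assoc, CharTwo.add_self_eq_zero,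
      add_zero]
  · simp [shear, h]

/-- The encoder of the half `z_i = 0` of the code. -/
def encodeZero (u : {B : Finset (Fin m) // i ∉ B} → ZMod 2) (z : {z : Fin m → ZMod 2 // z i = 0}) :
    ZMod 2 :=
  ∑ B, u B * monomialEval B.1 z.1

/-- The encoder of the half `z_i = 1` of the code. -/
def encodeOne (u : {B : Finset (Fin m) // ¬ i ∉ B} → ZMod 2)
    (z : {z : Fin m → ZMod 2 // ¬ z i = 0}) : ZMod 2 :=
  ∑ B, u B * monomialEval B.1 z.1

lemma encode_of_eq_zero (u : Finset (Fin m) → ZMod 2) (z : {z : Fin m → ZMod 2 // z i = 0}) :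
    encode u z.1 = encodeZero i (fun B => shear i u B.1) z := by
  unfold encode encodeZero
  rw [← Fintype.sum_subtype_add_sum_subtype (fun B : Finset (Fin m) => i ∉ B), add_eq_left.2]
  · refine sum_congr rfl fun B _ => ?_
    simp only [shear, if_neg B.2]
  · refine sum_eq_zero fun B _ => ?_
    have : monomialEval B.1 z.1 = 0 := prod_eq_zero (not_not.1 B.2) z.2
    rw [this, mul_zero]

/-- Where `z_i = 1`, the monomials of `B` and `B \ {i}` agree, so their coefficients add up. -/
lemma encode_of_ne_zero (u : Finset (Fin m) → ZMod 2) (z : {z : Fin m → ZMod 2 // ¬ z i = 0}) :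
    encode u z.1 = encodeOne i (fun B => shear i u B.1) z := by
  have hz : z.1 i = 1 := (by decide : ∀ x : ZMod 2, ¬ x = 0 → x = 1) _ z.2
  have herase : ∀ B : {B : Finset (Fin m) // ¬ i ∉ B},
      monomialEval (B.1.erase i) z.1 = monomialEval B.1 z.1 := fun B => by
    unfold monomialEval
    rw [← mul_prod_erase _ _ (not_not.1 B.2), hz, one_mul]
  have hreindex : ∑ B : {B : Finset (Fin m) // i ∉ B}, u B.1 * monomialEval B.1 z.1 =
      ∑ B : {B : Finset (Fin m) // ¬ i ∉ B}, u (B.1.erase i) * monomialEval B.1 z.1 := by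
    symm
    refine sum_bij' (fun B _ => ⟨B.1.erase i, notMem_erase _ _⟩)
      (fun B _ => ⟨insert i B.1, not_not.2 (mem_insert_self _ _)⟩) ?_ ?_ ?_ ?_ ?_
    · simp
    · simp
    · rintro ⟨B, hB⟩ _
      simpa using insert_erase (not_not.1 hB)
    · rintro ⟨B, hB⟩ _
      simpa using erase_insert hB
    · intro B _
      rw [herase]
  unfold encode encodeOne
  rw [← Fintype.sum_subtype_add_sum_subtype (fun B : Finset (Fin m) => i ∉ B), hreindex,
    ← sum_add_distrib]
  refine sum_congr rfl fun B _ => ?_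
  simp only [shear, if_pos (not_not.1 B.2)]
  ring

variable {𝒴 : Type*}

/-- The decomposition of the sample space along the coordinate `i`. -/
def splitEquiv : Sample m 𝒴 ≃
    (({B : Finset (Fin m) // i ∉ B} → ZMod 2) × ({z : Fin m → ZMod 2 // z i = 0} → 𝒴)) ×
    (({B : Finset (Fin m) // ¬ i ∉ B} → ZMod 2) × ({z : Fin m → ZMod 2 // ¬ z i = 0} → 𝒴)) :=
  (Equiv.prodCongr
    ((Function.Involutive.toPerm (shear i) (shear_shear i)).trans
      (Equiv.piEquivPiSubtypeProd (fun B : Finset (Fin m) => i ∉ B) fun _ => ZMod 2))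
    (Equiv.piEquivPiSubtypeProd (fun z : Fin m → ZMod 2 => z i = 0) fun _ => 𝒴)).trans
  (Equiv.prodProdProdComm _ _ _ _)

/-- The shear permutes the bit vectors, so the sheared bits are again uniform, and each half of the
outputs depends on its own bits only. -/
lemma jointLaw_eq_mul [Fintype 𝒴] (W : BMSChannel 𝒴) (ω : Sample m 𝒴) :
    jointLaw W m ω = encoderLaw W (encodeZero i) (splitEquiv i ω).1 *
      encoderLaw W (encodeOne i) (splitEquiv i ω).2 := by
  rw [jointLaw_eq_encoderLaw]
  unfold encoderLaw
  rw [mul_mul_mul_comm, ← pow_add, ← Fintype.card_sum,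
    Fintype.card_congr (Equiv.sumCompl fun B : Finset (Fin m) => i ∉ B),
    ← Fintype.prod_subtype_mul_prod_subtype (fun z : Fin m → ZMod 2 => z i = 0)]
  simp_rw [encode_of_eq_zero, encode_of_ne_zero]
  rfl

end Splitting

/-! ### Compatibility of the order with inserting and erasing -/

section Order

variable {m : ℕ} {i : Fin m} {A B : Finset (Fin m)}

lemma rmLT_insert_self (hi : i ∉ A) : rmLT (insert i A) A :=
  Or.inl (by rw [card_insert_of_notMem hi]; exact Nat.lt_succ_self _)

lemma rmLT_of_erase (hi : i ∈ B) (h : rmLT (B.erase i) A) : rmLT B A := by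
  have hc := card_erase_add_one hi
  rcases h with h | ⟨h, -⟩ <;> exact Or.inl (by omega)

lemma rmLT_of_rmLT_insert (hi : i ∉ A) (h : rmLT B (insert i A)) : rmLT B A := by
  have hc := card_insert_of_notMem hi
  rcases h with h | ⟨h, -⟩ <;> exact Or.inl (by omega)

/-- Erasing a common element lowers both sizes by one and preserves the colexicographic order. -/
lemma rmLT_erase_of_rmLT_insert (hi : i ∉ A) (hB : i ∈ B) (h : rmLT B (insert i A)) :
    rmLT (B.erase i) A := by
  have hc := card_insert_of_notMem hi
  have hd := card_erase_add_one hB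
  rcases h with h | ⟨h, hlt⟩
  · exact Or.inl (by omega)
  · refine Or.inr ⟨by omega, ?_⟩
    have := (Colex.toColex_sdiff_lt_toColex_sdiff (singleton_subset_iff.2 hB)
      (singleton_subset_iff.2 (mem_insert_self i A))).2 hlt
    rwa [sdiff_singleton_eq_erase, sdiff_singleton_eq_erase, erase_insert hi] at this

end Order

/-! ### The squaring inequality -/

section Squaring

variable {𝒴 : Type*} {m : ℕ} {i : Fin m} {A : Finset (Fin m)}

/-- The part of the observation of `U_A` that lies in the half `z_i = 0`. -/
def observationZero (i : Fin m) (A : Finset (Fin m))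
    (ω : ({B : Finset (Fin m) // i ∉ B} → ZMod 2) × ({z : Fin m → ZMod 2 // z i = 0} → 𝒴)) :
    ({z : Fin m → ZMod 2 // z i = 0} → 𝒴) ×
      ({B : {B : Finset (Fin m) // i ∉ B} // rmLT B.1 A} → ZMod 2) :=
  (ω.2, fun B => ω.1 B.1)

/-- The part of the observation of `U_A` that lies in the half `z_i = 1`. -/
def observationOne (i : Fin m) (A : Finset (Fin m))
    (ω : ({B : Finset (Fin m) // ¬ i ∉ B} → ZMod 2) × ({z : Fin m → ZMod 2 // ¬ z i = 0} → 𝒴)) :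
    ({z : Fin m → ZMod 2 // ¬ z i = 0} → 𝒴) ×
      ({B : {B : Finset (Fin m) // ¬ i ∉ B} // rmLT (B.1.erase i) A} → ZMod 2) :=
  (ω.2, fun B => ω.1 B.1)

lemma splitEquiv_zero (ω : Sample m 𝒴) (B : {B : Finset (Fin m) // i ∉ B}) :
    (splitEquiv i ω).1.1 B = ω.1 B.1 :=
  show shear i ω.1 B.1 = _ by rw [shear, if_neg B.2]

lemma splitEquiv_one (ω : Sample m 𝒴) (B : {B : Finset (Fin m) // ¬ i ∉ B}) :
    (splitEquiv i ω).2.1 B = ω.1 B.1 + ω.1 (B.1.erase i) :=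
  show shear i ω.1 B.1 = _ by rw [shear, if_pos (not_not.1 B.2)]

lemma bit_insert_eq_add (hi : i ∉ A) :
    (bit (insert i A) : Sample m 𝒴 → ZMod 2) = fun ω => (splitEquiv i ω).1.1 ⟨A, hi⟩ +
      (splitEquiv i ω).2.1 ⟨insert i A, not_not.2 (mem_insert_self i A)⟩ := by
  ext ω
  simp only [splitEquiv_zero, splitEquiv_one, erase_insert hi, bit]
  rw [add_comm (ω.1 (insert i A)), ← add_assoc, CharTwo.add_self_eq_zero, zero_add]

/-- The larger sets `insert i A` and, if `B.erase i` precedes `A`, also `B` come before `A`; hence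
all summands that occur are known. -/
lemma factorsThrough_observation (hi : i ∉ A) :
    (fun ω : Sample m 𝒴 => (observationZero i A (splitEquiv i ω).1,
      observationOne i A (splitEquiv i ω).2, bit (insert i A) ω)).FactorsThrough
      (observation A) := by
  rintro ⟨u, y⟩ ⟨u', y'⟩ h
  obtain ⟨rfl, hu⟩ := Prod.mk.inj h
  have hu' : ∀ B, rmLT B A → u B = u' B := fun B hB => congrFun hu ⟨B, hB⟩
  refine Prod.ext (Prod.ext rfl ?_) (Prod.ext (Prod.ext rfl ?_) (hu' _ (rmLT_insert_self hi)))
  · funext B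
    simp only [observationZero, splitEquiv_zero]
    exact hu' _ B.2
  · funext B
    simp only [observationOne, splitEquiv_one]
    rw [hu' _ B.2, hu' _ (rmLT_of_erase (not_not.1 B.1.2) B.2)]

/-- Bits with `i ∉ B` are read off the first half; for `i ∈ B` the second half gives `u_B + u_{B \
{i}}`, and `B.erase i` precedes `A`, so the first half gives the summand to cancel. -/
lemma observation_insert_factorsThrough (hi : i ∉ A) :
    (observation (insert i A) : Sample m 𝒴 → _).FactorsThrough
      (fun ω => (observationZero i A (splitEquiv i ω).1,
        observationOne i A (splitEquiv i ω).2)) := by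
  rintro ⟨u, y⟩ ⟨u', y'⟩ h
  obtain ⟨h0, h1⟩ := Prod.mk.inj h
  obtain ⟨hy0, hu0⟩ := Prod.mk.inj h0
  obtain ⟨hy1, hu1⟩ := Prod.mk.inj h1
  have hu0' : ∀ B, i ∉ B → rmLT B A → u B = u' B := fun B hB hlt => by
    have := congrFun hu0 ⟨⟨B, hB⟩, hlt⟩
    simpa only [splitEquiv_zero] using this
  refine Prod.ext (funext fun z => ?_) (funext fun B => ?_)
  · by_cases hz : z i = 0
    · exact congrFun hy0 ⟨z, hz⟩
    · exact congrFun hy1 ⟨z, hz⟩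
  · obtain ⟨B, hB⟩ := B
    change u B = u' B
    by_cases hiB : i ∈ B
    · have hlt := rmLT_erase_of_rmLT_insert hi hiB hB
      have := congrFun hu1 ⟨⟨B, not_not.2 hiB⟩, hlt⟩
      simp only [splitEquiv_one] at this
      rw [hu0' _ (notMem_erase _ _) hlt] at this
      exact add_right_cancel this
    · exact hu0' B hiB (rmLT_of_rmLT_insert hi hB)

variable [Fintype 𝒴] (W : BMSChannel 𝒴)

lemma jointLaw_nonneg (ω : Sample m 𝒴) : 0 ≤ jointLaw W m ω := by
  rw [jointLaw_eq_encoderLaw]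
  exact encoderLaw_nonneg W _ ω

lemma sum_jointLaw : ∑ ω, jointLaw W m ω = 1 := by
  rw [jointLaw_eq_encoderLaw]
  exact sum_encoderLaw W _

variable [DecidableEq 𝒴]

lemma rmBhattacharyya_eq_joint (A : Finset (Fin m)) :
    rmBhattacharyya W A = jointBhattacharyya (jointLaw W m) (bit A) (observation A) := by
  refine bhattacharyya_eq_joint (fun x => ?_) _
  rw [jointLaw_eq_encoderLaw]
  exact law_encoderLaw_bit W _ A x

lemma rmBhattacharyya_nonneg (A : Finset (Fin m)) : 0 ≤ rmBhattacharyya W A := by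
  rw [rmBhattacharyya_eq_joint]
  exact jointBhattacharyya_nonneg _ _ _

set_option synthInstance.maxSize 1000 in
/-- Removing an element of `A` at least squares the Bhattacharyya parameter. -/
theorem rmBhattacharyya_le_sq_insert (hi : i ∉ A) :
    rmBhattacharyya W A ≤ rmBhattacharyya W (insert i A) ^ 2 := by
  set F := encoderLaw W (encodeZero i)
  set G := encoderLaw W (encodeOne i)
  set X₁ := fun ω : ({B : Finset (Fin m) // i ∉ B} → ZMod 2) ×
    ({z : Fin m → ZMod 2 // z i = 0} → 𝒴) => ω.1 ⟨A, hi⟩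
  set X₂ := fun ω : ({B : Finset (Fin m) // ¬ i ∉ B} → ZMod 2) ×
    ({z : Fin m → ZMod 2 // ¬ z i = 0} → 𝒴) => ω.1 ⟨insert i A, not_not.2 (mem_insert_self i A)⟩
  have hX₁ : (fun ω : Sample m 𝒴 => X₁ (splitEquiv i ω).1) = bit A :=
    funext fun ω => splitEquiv_zero ω _
  have hX₂ : (fun ω : Sample m 𝒴 => X₁ (splitEquiv i ω).1 + X₂ (splitEquiv i ω).2) =
      bit (insert i A) := (bit_insert_eq_add hi).symm
  have hF : ∀ ω, 0 ≤ F ω := encoderLaw_nonneg W _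
  have hG : ∀ ω, 0 ≤ G ω := encoderLaw_nonneg W _
  have hplus := jointBhattacharyya_plus (splitEquiv i) (jointLaw_eq_mul i W) hF hG X₁ X₂
    (observationZero i A) (observationOne i A)
  have hminus₁ := jointBhattacharyya_le_minus (splitEquiv i) (jointLaw_eq_mul i W) hF hG
    (sum_encoderLaw W _) X₁ X₂ (observationZero i A) (observationOne i A)
  -- The minus transform with the halves exchanged bounds the second factor by the same quantity, so
  -- the two halves need not be compared with each other.
  have hminus₂ := jointBhattacharyya_le_minus ((splitEquiv i).trans (Equiv.prodComm _ _))
    (fun ω => (jointLaw_eq_mul i W ω).trans (mul_comm _ _)) hG hF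
    (sum_encoderLaw W _) X₂ X₁ (observationOne i A) (observationZero i A)
  simp only [Equiv.trans_apply, Equiv.prodComm_apply, Prod.fst_swap, Prod.snd_swap,
    add_comm (X₂ _)] at hminus₂
  rw [hX₂] at hminus₁ hminus₂
  have hbit : ∀ ω : Sample m 𝒴, X₁ (splitEquiv i ω).1 + X₂ (splitEquiv i ω).2 =
      bit (insert i A) ω := congrFun hX₂
  simp_rw [hbit] at hplus
  rw [hX₁] at hplus
  have hobs := jointBhattacharyya_le_of_factorsThrough (jointLaw_nonneg W) (bit (insert i A))
    (observation_insert_factorsThrough (𝒴 := 𝒴) hi)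
  have hobs' := jointBhattacharyya_le_of_factorsThrough (jointLaw_nonneg W) (bit (insert i A))
    (Y' := fun ω : Sample m 𝒴 => (observationOne i A (splitEquiv i ω).2,
      observationZero i A (splitEquiv i ω).1))
    (Y := observation (insert i A)) fun ω ω' h =>
      observation_insert_factorsThrough (𝒴 := 𝒴) hi
        (Prod.ext (congrArg Prod.snd h) (congrArg Prod.fst h))
  rw [rmBhattacharyya_eq_joint, rmBhattacharyya_eq_joint, sq]
  refine (jointBhattacharyya_le_of_factorsThrough (jointLaw_nonneg W) (bit A)
    (factorsThrough_observation (𝒴 := 𝒴) hi)).trans ?_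
  rw [hplus]
  exact mul_le_mul (hminus₁.trans hobs) (hminus₂.trans hobs')
    (jointBhattacharyya_nonneg _ _ _) (jointBhattacharyya_nonneg _ _ _)

lemma rmBhattacharyya_le_of_rmEntropy_le {t : ℝ} (ht : 0 ≤ t)
    (hH : rmEntropy W A ≤ 1 - t) : rmBhattacharyya W A ≤ 1 - t ^ 2 / 2 := by
  rw [rmBhattacharyya_eq_joint]
  exact jointBhattacharyya_le_of_condEntropy_le (jointLaw_nonneg W) (sum_jointLaw W) _ _ ht hH

end Squaring

/-! ### Iteration along a chain, counting and asymptotics -/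

open Filter

section Chain

variable {𝒴 : Type*} [Fintype 𝒴] [DecidableEq 𝒴] (W : BMSChannel 𝒴) {m : ℕ}
  {A : Fin (m + 1) → Finset (Fin m)}

/-- Along an increasing chain the Bhattacharyya parameters decay doubly exponentially. -/
lemma rmBhattacharyya_chain_le_pow (hA : IsIncreasingChain A) (k : ℕ) (i j : Fin (m + 1))
    (hij : i.1 + k = j.1) :
    rmBhattacharyya W (A i) ≤ rmBhattacharyya W (A j) ^ 2 ^ k := by
  induction k generalizing j with
  | zero =>
    obtain rfl : i = j := Fin.ext (by simpa using hij)
    simp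
  | succ k ih =>
    obtain ⟨l, hl⟩ : ∃ l : Fin (m + 1), i.1 + k = l.1 := ⟨⟨i.1 + k, by omega⟩, rfl⟩
    obtain ⟨x, hx, hins⟩ := exists_eq_insert_iff.2
      ⟨hA.1 (show l ≤ j from Fin.le_def.2 (by omega)),
        show (A l).card + 1 = (A j).card by rw [hA.2, hA.2]; omega⟩
    have hsq := rmBhattacharyya_le_sq_insert W hx
    rw [hins] at hsq
    calc rmBhattacharyya W (A i) ≤ rmBhattacharyya W (A l) ^ 2 ^ k := ih l hl
      _ ≤ (rmBhattacharyya W (A j) ^ 2) ^ 2 ^ k :=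
        pow_le_pow_left₀ (rmBhattacharyya_nonneg W _) hsq _
      _ = rmBhattacharyya W (A j) ^ 2 ^ (k + 1) := by rw [← pow_mul, pow_succ, mul_comm 2]

end Chain

/-- The minimum and maximum of `s` work, since `s` lies in the interval between them. -/
lemma exists_add_le_of_lt_card {m n : ℕ} {s : Finset (Fin (m + 1))} (hs : n < s.card) :
    ∃ i ∈ s, ∃ j ∈ s, ∃ q, n ≤ q ∧ i.1 + q = j.1 := by
  have hne : s.Nonempty := card_pos.1 (by omega)
  refine ⟨s.min' hne, s.min'_mem hne, s.max' hne, s.max'_mem hne,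
    (s.max' hne).1 - (s.min' hne).1, ?_, ?_⟩
  · have hsub : s ⊆ Icc (s.min' hne) (s.max' hne) := fun x hx =>
      mem_Icc.2 ⟨s.min'_le x hx, s.le_max' x hx⟩
    have := card_le_card hsub
    rw [Fin.card_Icc] at this
    omega
  · have : (s.min' hne).1 ≤ (s.max' hne).1 := Fin.le_def.1 (s.min'_le _ (s.max'_mem hne))
    omega

lemma eventually_pow_two_pow_lt {r c d γ : ℝ} (hr0 : 0 < r) (hr1 : r < 1) (hc : 0 < c)
    (hγ : 0 < γ) : ∀ᶠ m : ℕ in atTop, ∀ n : ℕ, (m : ℝ) ^ γ ≤ n →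
      r ^ 2 ^ n < c * ((2 ^ m : ℕ) : ℝ) ^ (-d) := by
  have hL : 0 < -Real.log r := neg_pos.2 (Real.log_neg hr0 hr1)
  have hlog2 : 0 < Real.log 2 := Real.log_pos one_lt_two
  -- Chosen so that -log r · K m dominates m |d| log 2 + |log c| for m ≥ 1; the summand 1 makes the
  -- final inequality strict.
  set K := (|d| * Real.log 2 + |Real.log c| + 1) / -Real.log r with hKdef
  have hK : 0 < K := by positivity
  -- At x = m^γ, x^(1/γ) = o(2^x) says that m = o(2^(m^γ)).
  have ho := (isLittleO_rpow_exp_pos_mul_atTop (1 / γ) hlog2).comp_tendsto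
    ((tendsto_rpow_atTop hγ).comp tendsto_natCast_atTop_atTop)
  filter_upwards [ho.bound (inv_pos.2 hK), eventually_ge_atTop 1] with m hm hm1 n hn
  have hm1' : (1 : ℝ) ≤ m := by exact_mod_cast hm1
  have hpow : K * m ≤ 2 ^ n := by
    simp only [Function.comp_apply] at hm
    rw [← Real.rpow_mul (Nat.cast_nonneg m), mul_one_div_cancel hγ.ne', Real.rpow_one,
      Real.norm_of_nonneg (Nat.cast_nonneg m), Real.norm_of_nonneg (Real.exp_pos _).le,
      le_inv_mul_iff₀ hK] at hm
    refine hm.trans ?_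
    rw [← Real.rpow_natCast, Real.rpow_def_of_pos two_pos]
    exact Real.exp_le_exp.2 (mul_le_mul_of_nonneg_left hn hlog2.le)
  have hlhs : r ^ 2 ^ n = Real.exp (Real.log r * 2 ^ n) := by
    rw [← Real.rpow_natCast, Real.rpow_def_of_pos hr0]
    norm_cast
  have hrhs : c * ((2 ^ m : ℕ) : ℝ) ^ (-d) =
      Real.exp (Real.log c - m * Real.log 2 * d) := by
    rw [sub_eq_add_neg, Real.exp_add, Real.exp_log hc, Real.rpow_def_of_pos (by positivity)]
    push_cast
    rw [Real.log_pow, mul_neg]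
  rw [hlhs, hrhs, Real.exp_lt_exp]
  have h1 : -Real.log r * (K * m) ≤ -Real.log r * 2 ^ n := mul_le_mul_of_nonneg_left hpow hL.le
  have h2 : -Real.log r * (K * m) = (|d| * Real.log 2 + |Real.log c| + 1) * m := by
    rw [hKdef, ← mul_assoc, mul_div_cancel₀ _ hL.ne']
  have h3 : (m : ℝ) * Real.log 2 * d ≤ m * Real.log 2 * |d| :=
    mul_le_mul_of_nonneg_left (le_abs_self d) (by positivity)
  have h4 : |Real.log c| ≤ |Real.log c| * m := le_mul_of_one_le_right (abs_nonneg _) hm1'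
  linarith [neg_abs_le (Real.log c)]

end RMPolar

/-! ### Counting the bad indices -/

theorem mainTheorem6 (ε : ℝ) (hε0 : 0 < ε) (hε1 : ε < 1 / 10)
    (δ : ℕ → ℝ) (hδ : RMPolar.AtLeastInvPoly δ) (γ : ℝ) (hγ0 : 0 < γ) (hγ1 : γ < 1) :
    ∃ M : ℕ, ∀ (𝒴 : Type*) [Fintype 𝒴] [DecidableEq 𝒴] (W : RMPolar.BMSChannel 𝒴) (m : ℕ),
      M < m → ∀ A : Fin (m + 1) → Finset (Fin m), RMPolar.IsIncreasingChain A →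
        (m : ℝ) - (m : ℝ) ^ γ ≤
          (({i | 1 - ε < RMPolar.rmEntropy W (A i)} ∪
            {i | RMPolar.rmBhattacharyya W (A i) < δ (2 ^ m)}).ncard : ℝ) := by
  obtain ⟨c, d, hc, -, hcd⟩ := hδ
  have hr0 : 0 < 1 - ε ^ 2 / 2 := by nlinarith
  have hr1 : 1 - ε ^ 2 / 2 < 1 := by nlinarith
  obtain ⟨M, hM⟩ := Filter.eventually_atTop.1
    ((RMPolar.eventually_pow_two_pow_lt (d := d) hr0 hr1 hc hγ0).and
      ((tendsto_pow_atTop_atTop_of_one_lt (one_lt_two : 1 < 2)).eventually hcd))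
  refine ⟨M, fun 𝒴 _ _ W m hm A hA => ?_⟩
  obtain ⟨hdecay, hδm⟩ := hM m hm.le
  set good := {i | 1 - ε < RMPolar.rmEntropy W (A i)} ∪
    {i | RMPolar.rmBhattacharyya W (A i) < δ (2 ^ m)} with hgood
  classical
  set bad : Finset (Fin (m + 1)) := goodᶜ.toFinset with hbad
  have hcard : good.ncard + bad.card = m + 1 := by
    rw [hbad, ← Set.ncard_eq_toFinset_card', Set.ncard_add_ncard_compl, Nat.card_eq_fintype_card,
      Fintype.card_fin]
  have hmem : ∀ i ∈ bad, RMPolar.rmEntropy W (A i) ≤ 1 - ε ∧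
      δ (2 ^ m) ≤ RMPolar.rmBhattacharyya W (A i) := by
    intro i hi
    simpa [hbad, hgood] using hi
  have hcard' : (good.ncard : ℝ) + bad.card = m + 1 := by exact_mod_cast hcard
  -- There are m + 1 indices, hence the extra 1.
  suffices h : (bad.card : ℝ) ≤ 1 + (m : ℝ) ^ γ by linarith
  by_contra! hlt
  -- Needed for the truncated subtraction `bad.card - 1` below.
  have hpos : 0 < bad.card := by
    have : (0 : ℝ) < bad.card := lt_trans (by positivity) hlt
    exact_mod_cast this
  obtain ⟨i, hi, j, hj, q, hq, hij⟩ :=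
    RMPolar.exists_add_le_of_lt_card (n := bad.card - 1) (s := bad) (by omega)
  have hqγ : (m : ℝ) ^ γ ≤ q := by
    have h1 : bad.card ≤ q + 1 := by omega
    have h2 : (bad.card : ℝ) ≤ q + 1 := by exact_mod_cast h1
    linarith
  have hZ := (RMPolar.rmBhattacharyya_chain_le_pow W hA q i j hij).trans
    (pow_le_pow_left₀ (RMPolar.rmBhattacharyya_nonneg W _)
      (RMPolar.rmBhattacharyya_le_of_rmEntropy_le W hε0.le (hmem j hj).1) _)
  linarith [hdecay q hqγ, (hmem i hi).2]
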